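/- Let $\mathbb F_\omega$ be the free group on letters $a_0,a_1,\dots$, and let $\mathscr G$ be the space of marked groups, that is, the set of normal subgroups $N$ of $\mathbb F_\omega$ with the topology of a subspace of the Cantor space $\{0,1\}^{\mathbb F_\omega}$; the point $N$ stands for the countable group $\mathbb F_\omega/N$ generated by the images of the $a_i$. Let $\mathscr G_{fg}=\bigcup_{m\ge 1}\{N\in\mathscr G : a_i\in N\text{ for all } i\ge m\}$ be the space of finitely generated marked groups, whose Borel sets are the sets $\mathscr G_{fg}\cap B$ with $B$ Borel in $\mathscr G$. A subset of a standard Borel space $Y$ is analytic if it is the projection to $Y$ of a Borel subset of $X\times Y$ for an uncountable standard Borel space $X$, and $\Pi^1_1$ if its complement is analytic. Let $\mathcal M_C\subseteq\mathscr G$ be the set of marked groups $G$ that satisfy the minimal condition on centralizers: there is no infinite strictly decreasing chain $C_0>C_1>\cdots$ of subgroups of $G$ of the form $C_n=C_G(A_n)$ with $A_n\subseteq G$. Fix an enumeration $(\gamma_i)_{i\in\mathbb N}$ of $\mathbb F_\omega$ (repetitions allowed), and for $G=\mathbb F_\omega/N$ let $g_i=\gamma_iN$. Let $T_G$ be the tree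 of finite sequences $(s_0,\dots,s_{n-1})$ of natural numbers such that $C_G(g_{s_0},\dots,g_{s_k})\ne C_G(g_{s_0},\dots,g_{s_{k-1}})$ for all $k<n$ (where $C_G(\emptyset)=G$). For $G\in\mathcal M_C$ this tree has no infinite branch, and the centralizer rank of $G$ is $\rho_{T_G}(\emptyset)+1$, where $\rho_T(t)=\sup\{\rho_T(s)+1 : s\in T \text{ properly extends } t\}$ for $t\in T$ (and $\sup\emptyset=0$). Then: 1. $\mathcal M_C$ is $\Pi^1_1$ and not Borel in $\mathscr G$. 2. $\mathcal M_C\cap\mathscr G_{fg}$ is $\Pi^1_1$ and not Borel in $\mathscr G_{fg}$. 3. The centralizer rank takes values below $\omega_1$ on $\mathcal M_C$ and is unbounded below $\omega_1$, even on finitely generated groups: for every $\alpha<\omega_1$ there is $G\in\mathcal M_C\cap\mathscr G_{fg}$ whose centralizer rank is at least $\alpha$. -/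

import Mathlib

open scoped Ordinal

/-! ### Analytic and co-analytic subsets of a standard Borel space -/

/-- A subset of a standard Borel space `Y` is analytic (`Σ¹₁`) if it is the projection to `Y` of a
Borel subset of `X × Y`, where `X` is an uncountable standard Borel space. All uncountable standard
Borel spaces are Borel isomorphic; `X` is taken to be the Baire space. -/
def IsSigma11 {Y : Type*} [MeasurableSpace Y] (A : Set Y) : Prop :=
  ∃ B : Set ((ℕ → ℕ) × Y), MeasurableSet B ∧ Prod.snd '' B = A

/-- Co-analytic (`Π¹₁`) sets: complements of analytic sets. -/
def IsPi11 {Y : Type*} [MeasurableSpace Y] (C : Set Y) : Prop :=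
  IsSigma11 Cᶜ

/-! ### The space of marked groups -/

/-- A marked group: a normal subgroup `N` of the free group on letters `a₀, a₁, …`, which stands
for the quotient with the images of the letters as distinguished generators. -/
structure MarkedGroup where
  ker : Subgroup (FreeGroup ℕ)
  normal : ker.Normal

namespace MarkedGroup

instance (N : MarkedGroup) : N.ker.Normal := N.normal

/-- The countable group that is marked. -/
abbrev Carrier (N : MarkedGroup) : Type := FreeGroup ℕ ⧸ N.ker

/-- The characteristic function of the kernel, a point of the Cantor space. -/
noncomputable def toCantor (N : MarkedGroup) : FreeGroup ℕ → Bool := by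
  classical exact fun w => decide (w ∈ N.ker)

/-- The topology of a subspace of the Cantor space `2 ^ 𝔽_ω` (product of discrete spaces). -/
noncomputable instance : TopologicalSpace MarkedGroup := TopologicalSpace.induced toCantor inferInstance

noncomputable instance : MeasurableSpace MarkedGroup := borel MarkedGroup

instance : BorelSpace MarkedGroup := ⟨rfl⟩

/-- The `m`-generated marked groups: `aᵢ` is trivial for all `i ≥ m`. -/
def generatedBy (m : ℕ) : Set MarkedGroup :=
  {N | ∀ i, m ≤ i → FreeGroup.of i ∈ N.ker}

/-- The finitely generated marked groups. As a subtype, this set carries the σ-algebra of the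
traces of the Borel sets of `MarkedGroup`. -/
def finGen : Set MarkedGroup :=
  ⋃ m ≥ 1, generatedBy m

end MarkedGroup

/-! ### The minimal condition on centralizers -/

/-- `H` is the centralizer in `G` of some subset of `G`. -/
def IsCentralizer {G : Type*} [Group G] (H : Subgroup G) : Prop :=
  ∃ A : Set G, H = Subgroup.centralizer A

/-- No infinite strictly decreasing chain of centralizers. -/
def MinCentralizers (G : Type*) [Group G] : Prop :=
  ¬ ∃ C : ℕ → Subgroup G, (∀ n, IsCentralizer (C n)) ∧ ∀ n, C (n + 1) < C n

/-- The marked groups whose underlying group has the minimal condition on centralizers. -/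
def MarkedGroup.classMC : Set MarkedGroup :=
  {N | MinCentralizers N.Carrier}

/-! ### Ranks of trees of finite sequences of natural numbers -/

namespace SeqTree

/-- `x` is a branch of `T`: all finite initial segments of `x` lie in `T`. -/
def IsBranch (T : Descriptive.tree ℕ) (x : ℕ → ℕ) : Prop :=
  ∀ n, (List.range n).map x ∈ T

/-- A tree is well-founded if it has no branch. -/
def IsWF (T : Descriptive.tree ℕ) : Prop :=
  ¬ ∃ x, IsBranch T x

/-- `s` is a proper extension of `t`. -/
def ProperExt (T : Descriptive.tree ℕ) (s t : T) : Prop :=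
  t.1 <+: s.1 ∧ t.1 ≠ s.1

theorem IsWF.wellFounded {T : Descriptive.tree ℕ} (hT : IsWF T) : WellFounded (ProperExt T) := by
  rw [wellFounded_iff_isEmpty_descending_chain]
  refine ⟨fun ⟨f, hf⟩ => hT ?_⟩
  have hlen : ∀ n, n ≤ (f n).1.length := by
    intro n
    induction n with
    | zero => exact Nat.zero_le _
    | succ k ih =>
      have h := hf k
      have h1 := h.1.length_le
      have h2 : (f k).1.length ≠ (f (k + 1)).1.length := fun e => h.2 (h.1.eq_of_length e)
      omega
  have hpre : ∀ m n, m ≤ n → (f m).1 <+: (f n).1 := by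
    intro m n hmn
    induction n, hmn using Nat.le_induction with
    | base => exact List.prefix_rfl
    | succ k _ ih => exact ih.trans (hf k).1
  refine ⟨fun n => (f (n + 1)).1[n]'(hlen (n + 1)), fun n => ?_⟩
  have e : (List.range n).map (fun n => (f (n + 1)).1[n]'(hlen (n + 1))) = (f n).1.take n := by
    apply List.ext_getElem
    · simpa using hlen n
    · intro i h1 h2
      have hi : i < n := by simpa using h1
      simpa using (hpre (i + 1) n hi).getElem (hlen (i + 1))
  rw [e]
  exact Descriptive.Tree.take_mem (f n)

/-- `ρ_T(t)` for a node `t` of a well-founded tree `T`: the supremum of `ρ_T(s) + 1` over the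
proper extensions `s` of `t` in `T` (so `0` if there are none). -/
noncomputable def nodeRank {T : Descriptive.tree ℕ} (hT : IsWF T) (t : T) : Ordinal.{0} :=
  (hT.wellFounded.apply t).rank

open Classical in
/-- The rank of a tree: `0` for the empty tree, `ρ_T(∅) + 1` for a nonempty well-founded tree, and
`ω₁` for a tree with a branch. -/
noncomputable def rank (T : Descriptive.tree ℕ) : Ordinal.{0} :=
  if h : IsWF T then
    if h0 : [] ∈ T then nodeRank h ⟨[], h0⟩ + 1 else 0
  else ω₁

end SeqTree

/-! ### The centralizer rank -/

/-- The set `{g_{s₀}, …, g_{sₙ}}` that a finite sequence `s` picks from an enumeration `g`. -/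
def seqSet {G : Type*} (g : ℕ → G) (s : List ℕ) : Set G :=
  {x | ∃ i ∈ s, g i = x}

/-- Nodes of the centralizer tree of a group enumerated by `g`: the empty sequence is a node, and a
node `s` is extended by `i` if adding `g i` to `{g_s}` changes the centralizer. -/
inductive IsCentralizerNode {G : Type*} [Group G] (g : ℕ → G) : List ℕ → Prop
  | nil : IsCentralizerNode g []
  | snoc (s : List ℕ) (i : ℕ) (hs : IsCentralizerNode g s)
      (hi : Subgroup.centralizer (seqSet g s ∪ {g i}) ≠ Subgroup.centralizer (seqSet g s)) :
      IsCentralizerNode g (s ++ [i])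

theorem IsCentralizerNode.of_snoc {G : Type*} [Group G] {g : ℕ → G} {s : List ℕ} {i : ℕ}
    (h : IsCentralizerNode g (s ++ [i])) : IsCentralizerNode g s := by
  generalize e : s ++ [i] = t at h
  cases h with
  | nil => simp at e
  | snoc s' i' hs hi =>
    obtain ⟨rfl, -⟩ := List.append_inj' e rfl
    exact hs

/-- The centralizer tree. -/
def centralizerTree {G : Type*} [Group G] (g : ℕ → G) : Descriptive.tree ℕ :=
  ⟨{s | IsCentralizerNode g s}, fun _ _ h => IsCentralizerNode.of_snoc h⟩

/-- The rank of the centralizer tree of a marked group `N`, which is enumerated by the images of an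
enumeration `γ` of the free group. For `N` in `classMC` this is the centralizer rank. -/
noncomputable def MarkedGroup.centralizerRank (γ : ℕ → FreeGroup ℕ) (N : MarkedGroup) :
    Ordinal.{0} :=
  SeqTree.rank (centralizerTree fun i => (QuotientGroup.mk (γ i) : N.Carrier))

/-! The minimal condition fails exactly when the group has a half chain (`not_minCentralizers_iff`).
After lifting to words, a half chain is a point of the Baire space subject to countably many
conditions on membership in the kernel, so the class is co-analytic.

For the lower bound, a set `T` of finite sequences is sent in a Borel way to a 2-generated group for
which the minimal condition fails if and only if `T` has a branch (`SeqTree.notMem_classMC_iff`). A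
diagonal argument shows that having a branch is not a Borel property
(`not_measurableSet_illFounded`).

The group is an extension of `ℤ` by a nilpotent group of class two, generated by a translation and
one delta function; the delta functions at `i ≠ j` commute if and only if an even function `c`
vanishes at `i - j`. Each sequence `s` receives two places, `lo s` and `hi s`, which are distinct
powers of four, and `c` vanishes precisely at the distances `hi t - lo s` with `s` an initial
segment of `t` and all initial segments of `t` in `T`. Differences of powers of four determine their
exponents, so translation invariance creates no unwanted relations between these places. A branch
then gives a half chain of delta functions. Conversely, the supports of a half chain give an
infinite set of integers whose finite subsets have infinitely many common neighbours
(`exists_infinite_of_isHalfChain`); up to a reflection and a translation it consists of places `lo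
s` of pairwise comparable sequences, and these trace out a branch.

Ranks are countable because the trees are countable. For large ranks, `T` is the tree of descending
sequences in a countable ordinal `α`: it has no branch, and it maps into the centralizer tree of its
group with strict extensions preserved (`le_nodeRank_nodeOf`). -/

open scoped commutatorElement

/-! ### Half chains -/

/-- `y n` commutes with `a j` for `j < n` but not for `j = n`. -/
def IsHalfChain {G : Type*} [Group G] (a y : ℕ → G) : Prop :=
  ∀ n, (∀ j < n, Commute (y n) (a j)) ∧ ¬ Commute (y n) (a n)

/-- Each strict drop in a chain is witnessed by an element of the larger centralizer and a member of
the next defining set with which it does not commute. Conversely, the centralizers of the initial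
parts of `a` descend strictly. -/
theorem not_minCentralizers_iff {G : Type*} [Group G] :
    ¬ MinCentralizers G ↔ ∃ a y : ℕ → G, IsHalfChain a y := by
  rw [MinCentralizers, not_not]
  constructor
  · rintro ⟨C, hC, hlt⟩
    choose A hA using hC
    have hanti : Antitone C := antitone_nat_of_succ_le fun n => (hlt n).le
    have hex : ∀ n, ∃ y ∈ C n, ∃ a ∈ A (n + 1), ¬ Commute y a := by
      intro n
      obtain ⟨y, hy, hy'⟩ := SetLike.exists_of_lt (hlt n)
      rw [hA (n + 1), Subgroup.mem_centralizer_iff] at hy'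
      push Not at hy'
      obtain ⟨a, ha, hne⟩ := hy'
      exact ⟨y, hy, a, ha, fun h => hne h.eq.symm⟩
    choose y hy a ha hne using hex
    refine ⟨a, y, fun n => ⟨fun j hj => ?_, hne n⟩⟩
    have h := hanti (Nat.succ_le_of_lt hj) (hy n)
    rw [Nat.succ_eq_add_one, hA (j + 1), Subgroup.mem_centralizer_iff] at h
    exact (h _ (ha j)).symm
  · rintro ⟨a, y, h⟩
    refine ⟨fun n => Subgroup.centralizer (a '' Set.Iio n), fun n => ⟨_, rfl⟩, fun n => ?_⟩
    refine SetLike.lt_iff_le_and_exists.2 ⟨Subgroup.centralizer_le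
      (Set.image_mono (Set.Iio_subset_Iio n.le_succ)), y n, ?_, fun hy => (h n).2 ?_⟩
    · rw [Subgroup.mem_centralizer_iff]
      rintro _ ⟨j, hj, rfl⟩
      exact ((h n).1 j hj).eq.symm
    · rw [Subgroup.mem_centralizer_iff] at hy
      exact (hy _ ⟨n, n.lt_succ_self, rfl⟩).symm

namespace MarkedGroup

theorem commute_mk_iff (N : MarkedGroup) (u v : FreeGroup ℕ) :
    Commute (QuotientGroup.mk u : N.Carrier) (QuotientGroup.mk v) ↔ ⁅u, v⁆ ∈ N.ker := by
  rw [← QuotientGroup.eq_one_iff, ← commutatorElement_eq_one_iff_commute]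
  rfl

theorem notMem_classMC_iff (N : MarkedGroup) :
    N ∉ classMC ↔ ∃ a y : ℕ → FreeGroup ℕ,
      ∀ n, (∀ j < n, ⁅y n, a j⁆ ∈ N.ker) ∧ ⁅y n, a n⁆ ∉ N.ker := by
  rw [classMC, Set.mem_ofPred_eq, not_minCentralizers_iff]
  constructor
  · rintro ⟨a, y, h⟩
    choose a' ha using fun n => QuotientGroup.mk_surjective (a n)
    choose y' hy using fun n => QuotientGroup.mk_surjective (y n)
    refine ⟨a', y', fun n => ⟨fun j hj => ?_, ?_⟩⟩
    · rw [← commute_mk_iff, ha j, hy n]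
      exact (h n).1 j hj
    · rw [← commute_mk_iff, ha n, hy n]
      exact (h n).2
  · rintro ⟨a, y, h⟩
    refine ⟨fun n => QuotientGroup.mk (a n), fun n => QuotientGroup.mk (y n), fun n =>
      ⟨fun j hj => ?_, ?_⟩⟩
    · exact (N.commute_mk_iff _ _).2 ((h n).1 j hj)
    · exact fun hc => (h n).2 ((N.commute_mk_iff _ _).1 hc)

/-! ### Measurability in the space of marked groups -/

theorem measurableSpace_eq_comap :
    (inferInstance : MeasurableSpace MarkedGroup) =
      MeasurableSpace.comap toCantor MeasurableSpace.pi := by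
  change borel MarkedGroup = _
  rw [borel_comap, (Pi.borelSpace (X := fun _ : FreeGroup ℕ => Bool)).measurable_eq]

theorem measurableSet_mem_ker (w : FreeGroup ℕ) : MeasurableSet {N : MarkedGroup | w ∈ N.ker} := by
  have h : Measurable toCantor := by
    rw [measurable_iff_comap_le]
    exact measurableSpace_eq_comap.ge
  have h2 : MeasurableSet {N : MarkedGroup | toCantor N w = true} :=
    ((measurable_pi_apply w).comp h) (measurableSet_singleton true)
  simpa [toCantor] using h2

theorem measurable_of_mem_ker {α : Type*} [MeasurableSpace α] {f : α → MarkedGroup}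
    (h : ∀ w, MeasurableSet {x | w ∈ (f x).ker}) : Measurable f := by
  have h1 : Measurable (toCantor ∘ f) := by
    refine measurable_pi_lambda _ fun w => measurable_to_bool ?_
    have e : (fun x => (toCantor ∘ f) x w) ⁻¹' {true} = {x | w ∈ (f x).ker} := by
      ext x
      simp [toCantor]
    rw [e]
    exact h w
  rw [measurable_iff_comap_le] at h1 ⊢
  rw [← MeasurableSpace.comap_comp] at h1
  exact (MeasurableSpace.comap_mono measurableSpace_eq_comap.le).trans h1

theorem isPi11_classMC : IsPi11 classMC := by
  -- Through `p`, one point of the Baire space codes both sequences of a half chain.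
  obtain ⟨p, hp⟩ := exists_surjective_nat (FreeGroup ℕ × FreeGroup ℕ)
  have key : ∀ m n, MeasurableSet
      {q : (ℕ → ℕ) × MarkedGroup | ⁅(p (q.1 m)).2, (p (q.1 n)).1⁆ ∈ q.2.ker} := by
    intro m n
    have e : {q : (ℕ → ℕ) × MarkedGroup | ⁅(p (q.1 m)).2, (p (q.1 n)).1⁆ ∈ q.2.ker} =
        ⋃ k, ⋃ l, {q | q.1 m = k} ∩ {q | q.1 n = l} ∩ {q | ⁅(p k).2, (p l).1⁆ ∈ q.2.ker} := by
      ext q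
      simp
    rw [e]
    refine MeasurableSet.iUnion fun k => MeasurableSet.iUnion fun l => ?_
    have hfst : ∀ m k, MeasurableSet {q : (ℕ → ℕ) × MarkedGroup | q.1 m = k} := fun m k =>
      measurableSet_eq_fun ((measurable_pi_apply m).comp measurable_fst) measurable_const
    exact ((hfst m k).inter (hfst n l)).inter (measurable_snd (measurableSet_mem_ker _))
  refine ⟨⋂ n, (⋂ j, ⋂ _ : j < n, {q | ⁅(p (q.1 n)).2, (p (q.1 j)).1⁆ ∈ q.2.ker}) ∩
    {q | ⁅(p (q.1 n)).2, (p (q.1 n)).1⁆ ∈ q.2.ker}ᶜ, MeasurableSet.iInter fun n =>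
      (MeasurableSet.iInter fun j => MeasurableSet.iInter fun _ => key n j).inter
        (key n n).compl, ?_⟩
  ext N
  rw [Set.mem_compl_iff, notMem_classMC_iff]
  constructor
  · rintro ⟨⟨x, N⟩, hx, rfl⟩
    refine ⟨fun n => (p (x n)).1, fun n => (p (x n)).2, fun n => ?_⟩
    simpa using Set.mem_iInter.1 hx n
  · rintro ⟨a, y, h⟩
    choose x hx using fun n => hp (a n, y n)
    refine ⟨(x, N), Set.mem_iInter.2 fun n => ?_, rfl⟩
    simpa [hx] using h n

end MarkedGroup

theorem IsPi11.preimage {Y Z : Type*} [MeasurableSpace Y] [MeasurableSpace Z] {C : Set Y}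
    (hC : IsPi11 C) {f : Z → Y} (hf : Measurable f) : IsPi11 (f ⁻¹' C) := by
  obtain ⟨B, hB, hBC⟩ := hC
  refine ⟨Prod.map id f ⁻¹' B, (measurable_id.prodMap hf) hB, ?_⟩
  rw [← Set.preimage_compl, ← hBC]
  ext z
  constructor
  · rintro ⟨⟨x, z⟩, hx, rfl⟩
    exact ⟨_, hx, rfl⟩
  · rintro ⟨⟨x, y⟩, hx, hy⟩
    obtain rfl : y = f z := hy
    exact ⟨(x, z), hx, rfl⟩

/-! ### The ill-founded trees do not form a Borel set -/

namespace SeqTree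

/-- The sets of finite sequences that contain all initial segments of some infinite sequence. Finite
sequences are written in reverse order, as in `PiNat.res`. -/
def illFounded : Set (List ℕ → Bool) :=
  {T | ∃ x : ℕ → ℕ, ∀ n, T (PiNat.res x n) = true}

/-- Merge a point of the Cantor space into a sequence of natural numbers. -/
def mix (z : ℕ → Bool) (x : ℕ → ℕ) (n : ℕ) : ℕ :=
  Nat.pair (x n) (z n).toNat

/-- The action of `mix z` on finite sequences in reverse order. -/
def mixList (z : ℕ → Bool) : List ℕ → List ℕ
  | [] => []
  | a :: l => Nat.pair a (z l.length).toNat :: mixList z l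

theorem mixList_res (z : ℕ → Bool) (x : ℕ → ℕ) (n : ℕ) :
    mixList z (PiNat.res x n) = PiNat.res (mix z x) n := by
  induction n with
  | zero => rfl
  | succ n ih => simp [PiNat.res_succ, mixList, ih, mix]

theorem mix_eq_iff {z z' : ℕ → Bool} {x x' : ℕ → ℕ} {n : ℕ} :
    mix z x n = mix z' x' n ↔ x n = x' n ∧ z n = z' n := by
  rw [mix, mix, Nat.pair_eq_pair]
  refine and_congr_right fun _ => ⟨fun h => ?_, fun h => by rw [h]⟩
  cases h1 : z n <;> cases h2 : z' n <;> simp_all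

theorem measurable_mixList_section {d : ℕ → List ℕ} :
    Measurable fun T : List ℕ → Bool => fun l => T (mixList (fun n => T (d n)) l) := by
  refine measurable_pi_lambda _ fun l => ?_
  have h : ∀ l : List ℕ, ∀ m : List ℕ,
      MeasurableSet {T : List ℕ → Bool | mixList (fun n => T (d n)) l = m} := by
    intro l
    induction l with
    | nil =>
      intro m
      exact MeasurableSet.const ([] = m)
    | cons a l ih =>
      intro m
      cases m with
      | nil => simp [mixList]
      | cons b m =>
        simp only [mixList, List.cons.injEq]
        refine MeasurableSet.inter ?_ (ih m)
        exact ((measurable_of_countable fun c : Bool => Nat.pair a c.toNat).comp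
          (measurable_pi_apply (d l.length))) (measurableSet_singleton b)
  refine measurable_to_bool ?_
  have e : (fun T : List ℕ → Bool => T (mixList (fun n => T (d n)) l)) ⁻¹' {true} =
      ⋃ m, {T | mixList (fun n => T (d n)) l = m} ∩ {T | T m = true} := by
    ext T
    simp
  rw [e]
  have hT : ∀ m, MeasurableSet {T : List ℕ → Bool | T m = true} := fun m =>
    measurableSet_eq_fun (measurable_pi_apply m) measurable_const
  exact MeasurableSet.iUnion fun m => (h l m).inter (hT m)

-- Diagonal argument. The section `S T` has a branch if and only if `T` contains all initial
-- segments of some `mix z x`, where `z` codes `T` itself. If `illFounded` were Borel, the set of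
-- `T` with `S T` branchless would be a continuous image of the Baire space, and the tree of the
-- graph of the parametrization would belong to this set if and only if it does not.
open Classical in
theorem not_measurableSet_illFounded : ¬ MeasurableSet illFounded := by
  intro hIF
  let d : ℕ → List ℕ := fun n => (Encodable.decode n).getD []
  have hd : ∀ l, d (Encodable.encode l) = l := fun l => by simp [d]
  let S : (List ℕ → Bool) → (List ℕ → Bool) := fun T l => T (mixList (fun n => T (d n)) l)
  have hS : Measurable S := measurable_mixList_section
  have hD : MeasurableSet (S ⁻¹' illFoundedᶜ) := hS hIF.compl
  have : TopologicalSpace.IsCompletelyMetrizableSpace (List ℕ → Bool) :=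
    TopologicalSpace.IsCompletelyMetrizableSpace.pi_countable
  have hA := hD.analyticSet
  have hSmem : ∀ T, S T ∈ illFounded ↔
      ∃ x, ∀ n, T (PiNat.res (mix (fun n => T (d n)) x) n) = true := by
    intro T
    simp only [S, illFounded, Set.mem_ofPred_eq, mixList_res]
  rw [MeasureTheory.AnalyticSet] at hA
  rcases hA with h0 | ⟨φ, hφ, hr⟩
  · have : (fun _ => false : List ℕ → Bool) ∈ S ⁻¹' illFoundedᶜ := by
      rw [Set.mem_preimage, Set.mem_compl_iff]
      intro h
      obtain ⟨x, hx⟩ := (hSmem fun _ => false).1 h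
      exact Bool.false_ne_true (hx 0)
    rw [h0] at this
    exact this
  · let ψ : (ℕ → ℕ) → ℕ → Bool := fun x n => φ x (d n)
    -- The graph of a continuous map is closed, so the branches of this tree are exactly the points
    -- `mix (ψ x) x`.
    let T : List ℕ → Bool := fun l => decide (∃ x n, l = PiNat.res (mix (ψ x) x) n)
    have key : S T ∈ illFounded ↔ T ∈ S ⁻¹' illFoundedᶜ := by
      rw [hSmem, ← hr]
      constructor
      · rintro ⟨x, hx⟩
        refine ⟨x, ?_⟩
        -- Each initial segment of the branch comes from its own point `x'` of the graph; these
        -- points converge to `x`, and continuity of `φ` passes the second equation to the limit.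
        have hx' : ∀ n, ∃ x', ∀ m < n, x m = x' m ∧ T (d m) = ψ x' m := by
          intro n
          obtain ⟨x', n', h⟩ := of_decide_eq_true (hx n)
          have hn : n = n' := by simpa using congrArg List.length h
          subst hn
          exact ⟨x', fun m hm => mix_eq_iff.1 (PiNat.res_eq_res.1 h hm)⟩
        choose x' hx' using hx'
        have hlim : Filter.Tendsto x' Filter.atTop (nhds x) := by
          rw [tendsto_pi_nhds]
          intro m
          refine tendsto_const_nhds.congr' ?_
          filter_upwards [Filter.eventually_gt_atTop m] with n hn
          exact (hx' n m hn).1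
        funext l
        have h1 : Filter.Tendsto (fun n => φ (x' n) l) Filter.atTop (nhds (φ x l)) :=
          ((continuous_apply l).comp hφ).continuousAt.tendsto.comp hlim
        have h2 : Filter.Tendsto (fun n => φ (x' n) l) Filter.atTop (nhds (T l)) := by
          refine tendsto_const_nhds.congr' ?_
          filter_upwards [Filter.eventually_gt_atTop (Encodable.encode l)] with n hn
          have := (hx' n _ hn).2
          simpa only [ψ, hd] using this
        exact tendsto_nhds_unique h1 h2
      · rintro ⟨x, hx⟩
        refine ⟨x, fun n => decide_eq_true ⟨x, n, ?_⟩⟩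
        simp only [ψ, hx]
    exact (iff_not_self key).elim

end SeqTree

/-! ### A group with prescribed commutation between the translates of a generator -/

/-- Triples of a function on `ℤ`, a function on `ℤ × ℤ`, and an integer. They form a group, the
extension of `ℤ`, acting by translation, by a nilpotent group of class two, whose commutators are
determined by `c`: the coefficient function `c` vanishes at `i - j` if the delta functions at `i`
and `j` commute. -/
@[ext]
structure ShiftExt (c : ℤ → ZMod 2) where
  fst : ℤ → ZMod 2
  snd : ℤ → ℤ → ZMod 2
  shift : ℤ

namespace ShiftExt

variable {c : ℤ → ZMod 2}

instance : One (ShiftExt c) := ⟨⟨fun _ => 0, fun _ _ => 0, 0⟩⟩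

/-- The last summand of the second component is a bilinear cocycle. It is invariant under
simultaneous translation because `c` is evaluated at a difference, which is what makes the product
associative. -/
instance : Mul (ShiftExt c) := ⟨fun g h =>
  ⟨fun i => g.fst i + h.fst (i - g.shift),
    fun i j => g.snd i j + h.snd (i - g.shift) (j - g.shift) +
      c (i - j) * (g.fst i * h.fst (j - g.shift)),
    g.shift + h.shift⟩⟩

instance : Inv (ShiftExt c) := ⟨fun g =>
  ⟨fun i => -g.fst (i + g.shift),
    fun i j => -g.snd (i + g.shift) (j + g.shift) +
      c (i - j) * (g.fst (i + g.shift) * g.fst (j + g.shift)),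
    -g.shift⟩⟩

@[simp] theorem one_fst (i : ℤ) : (1 : ShiftExt c).fst i = 0 := rfl
@[simp] theorem one_snd (i j : ℤ) : (1 : ShiftExt c).snd i j = 0 := rfl
@[simp] theorem one_shift : (1 : ShiftExt c).shift = 0 := rfl
@[simp] theorem mul_fst (g h : ShiftExt c) (i : ℤ) :
    (g * h).fst i = g.fst i + h.fst (i - g.shift) := rfl
@[simp] theorem mul_snd (g h : ShiftExt c) (i j : ℤ) :
    (g * h).snd i j = g.snd i j + h.snd (i - g.shift) (j - g.shift) +
      c (i - j) * (g.fst i * h.fst (j - g.shift)) := rfl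
@[simp] theorem mul_shift (g h : ShiftExt c) : (g * h).shift = g.shift + h.shift := rfl
@[simp] theorem inv_fst (g : ShiftExt c) (i : ℤ) : g⁻¹.fst i = -g.fst (i + g.shift) := rfl
@[simp] theorem inv_snd (g : ShiftExt c) (i j : ℤ) :
    g⁻¹.snd i j = -g.snd (i + g.shift) (j + g.shift) +
      c (i - j) * (g.fst (i + g.shift) * g.fst (j + g.shift)) := rfl
@[simp] theorem inv_shift (g : ShiftExt c) : g⁻¹.shift = -g.shift := rfl

instance : Group (ShiftExt c) :=
  Group.ofLeftAxioms
    (fun g h k => by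
      ext i j
      · simp [sub_sub, add_assoc]
      · simp only [mul_snd, mul_fst, mul_shift, sub_sub_sub_cancel_right]
        simp only [sub_sub]
        ring
      · simp [add_assoc])
    (fun g => by ext <;> simp)
    (fun g => by
      ext i j
      · simp only [mul_fst, inv_fst, inv_shift, sub_neg_eq_add, neg_add_cancel, one_fst]
      · simp only [mul_snd, inv_fst, inv_snd, inv_shift, sub_neg_eq_add, one_snd]
        ring
      · simp)

/-- Translation by `n`. -/
def translation (n : ℤ) : ShiftExt c := ⟨fun _ => 0, fun _ _ => 0, n⟩

/-- The delta function at `i`. -/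
def delta (i : ℤ) : ShiftExt c := ⟨Pi.single i 1, fun _ _ => 0, 0⟩

theorem translation_zpow (n : ℤ) : (translation 1 : ShiftExt c) ^ n = translation n := by
  have h : ∀ m n : ℤ, (translation m * translation n : ShiftExt c) = translation (m + n) := by
    intro m n
    ext <;> simp [translation]
  have h0 : (translation 0 : ShiftExt c) = 1 := rfl
  let f : Multiplicative ℤ →* ShiftExt c :=
    ⟨⟨fun n => translation n.toAdd, h0⟩, fun m n => (h _ _).symm⟩
  have := map_zpow f (Multiplicative.ofAdd 1) n
  rw [← Int.ofAdd_mul, one_mul] at this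
  exact this.symm

theorem translation_conj_delta (n : ℤ) :
    (translation n * delta 0 * (translation n)⁻¹ : ShiftExt c) = delta n := by
  ext i j
  · simp [translation, delta, Pi.single_apply, sub_eq_zero]
  · simp [translation, delta]
  · simp [translation, delta]

/-- The marking: the first letter acts by translation, the second is a delta function, and all
others are trivial. -/
def marking (c : ℤ → ZMod 2) : FreeGroup ℕ →* ShiftExt c :=
  FreeGroup.lift fun k => if k = 0 then translation 1 else if k = 1 then delta 0 else 1

/-- A word that represents the delta function at `i`. -/
def deltaWord (i : ℤ) : FreeGroup ℕ :=
  FreeGroup.of 0 ^ i * FreeGroup.of 1 * (FreeGroup.of 0 ^ i)⁻¹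

theorem marking_deltaWord (c : ℤ → ZMod 2) (i : ℤ) : marking c (deltaWord i) = delta i := by
  simp [marking, deltaWord, translation_zpow, translation_conj_delta]

/-- The marked group generated by the translation and a delta function. -/
def toMarked (c : ℤ → ZMod 2) : MarkedGroup := ⟨(marking c).ker, inferInstance⟩

theorem toMarked_mem_finGen (c : ℤ → ZMod 2) : toMarked c ∈ MarkedGroup.finGen := by
  refine Set.mem_iUnion₂.2 ⟨2, by norm_num, fun i hi => ?_⟩
  have h0 : i ≠ 0 := by omega
  have h1 : i ≠ 1 := by omega
  simp [toMarked, MonoidHom.mem_ker, marking, h0, h1]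

theorem commutator_mem_toMarked_ker {u v : FreeGroup ℕ} :
    ⁅u, v⁆ ∈ (toMarked c).ker ↔ Commute (marking c u) (marking c v) := by
  rw [← commutatorElement_eq_one_iff_commute, ← map_commutatorElement]
  rfl

theorem marking_induction {p : FreeGroup ℕ → Prop} (one : p 1) (zero : p (FreeGroup.of 0))
    (first : p (FreeGroup.of 1)) (triv : ∀ k, (∀ c, marking c (FreeGroup.of k) = 1) →
      p (FreeGroup.of k))
    (inv : ∀ u, p u → p u⁻¹) (mul : ∀ u v, p u → p v → p (u * v)) (w : FreeGroup ℕ) : p w := by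
  have hof : ∀ k, p (FreeGroup.of k) := by
    intro k
    by_cases h0 : k = 0
    · exact h0 ▸ zero
    by_cases h1 : k = 1
    · exact h1 ▸ first
    exact triv k fun c => by simp [marking, h0, h1]
  induction w using FreeGroup.induction_on with
  | C1 => exact one
  | of k => exact hof k
  | inv_of k hk => exact inv _ hk
  | mul u v hu hv => exact mul u v hu hv

theorem marking_zero (c : ℤ → ZMod 2) : marking c (FreeGroup.of 0) = translation 1 := by
  simp [marking]

theorem marking_first (c : ℤ → ZMod 2) : marking c (FreeGroup.of 1) = delta 0 := by
  simp [marking]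

/-- The coefficient function enters the multiplication only through the second component. For a
fixed word, the other two components are therefore constant in `c`. -/
theorem measurable_marking (w : FreeGroup ℕ) :
    (∀ c c', (marking c w).fst = (marking c' w).fst ∧
      (marking c w).shift = (marking c' w).shift) ∧
    ∀ i j, Measurable fun c : ℤ → ZMod 2 => (marking c w).snd i j := by
  induction w using marking_induction with
  | one => simp [funext_iff, measurable_const]
  | zero => simp [marking_zero, translation, measurable_const]
  | first => simp [marking_first, delta, measurable_const]
  | triv k hk => simp [hk, funext_iff, measurable_const]
  | inv u hu =>
    refine ⟨fun c c' => ⟨funext fun i => ?_, ?_⟩, fun i j => ?_⟩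
    · simp [(hu.1 c c').1, (hu.1 c c').2]
    · simp [(hu.1 c c').2]
    · simp only [map_inv, inv_snd, (hu.1 _ 0).1, (hu.1 _ 0).2]
      exact (hu.2 _ _).neg.add ((measurable_pi_apply _).mul_const _)
  | mul u v hu hv =>
    refine ⟨fun c c' => ⟨funext fun i => ?_, ?_⟩, fun i j => ?_⟩
    · simp [(hu.1 c c').1, (hu.1 c c').2, (hv.1 c c').1]
    · simp [(hu.1 c c').2, (hv.1 c c').2]
    · simp only [map_mul, mul_snd, (hu.1 _ 0).1, (hu.1 _ 0).2, (hv.1 _ 0).1]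
      exact ((hu.2 _ _).add (hv.2 _ _)).add ((measurable_pi_apply _).mul_const _)

theorem measurable_toMarked : Measurable toMarked := by
  refine MarkedGroup.measurable_of_mem_ker fun w => ?_
  have e : {c | w ∈ (toMarked c).ker} =
      {c | (marking c w).fst = 0 ∧ (marking c w).shift = 0} ∩
        ⋂ i, ⋂ j, {c | (marking c w).snd i j = 0} := by
    ext c
    simp only [toMarked, MonoidHom.mem_ker, ShiftExt.ext_iff, funext_iff, Set.mem_ofPred_eq,
      Set.mem_inter_iff, Set.mem_iInter, one_fst, one_snd, one_shift, Pi.zero_apply]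
    tauto
  rw [e]
  refine MeasurableSet.inter ?_ (MeasurableSet.iInter fun i => MeasurableSet.iInter fun j =>
    (measurable_marking w).2 i j (measurableSet_singleton 0))
  simp only [((measurable_marking w).1 _ 0).1, ((measurable_marking w).1 _ 0).2]
  exact MeasurableSet.const _

/-- The elements whose components have finite supports. -/
def finSupp (c : ℤ → ZMod 2) : Set (ShiftExt c) :=
  {g | g.fst.support.Finite ∧ (Function.uncurry g.snd).support.Finite}

theorem exists_bound_of_mem_finSupp {g : ShiftExt c} (hg : g ∈ finSupp c) :
    ∃ b : ℤ, (∀ i, b < |i| → g.fst i = 0) ∧ ∀ i j, b < |i| ∨ b < |j| → g.snd i j = 0 := by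
  obtain ⟨h1, h2⟩ := hg
  obtain ⟨b1, hb1⟩ := (h1.image fun i => |i|).bddAbove
  obtain ⟨b2, hb2⟩ := (h2.image fun p => |p.1|).bddAbove
  obtain ⟨b3, hb3⟩ := (h2.image fun p => |p.2|).bddAbove
  refine ⟨max b1 (max b2 b3), fun i hi => ?_, fun i j hij => ?_⟩
  · by_contra h
    have := hb1 ⟨i, h, rfl⟩
    simp only [max_lt_iff] at hi
    exact absurd this hi.1.not_ge
  · by_contra h
    have h2 := hb2 ⟨(i, j), h, rfl⟩
    have h3 := hb3 ⟨(i, j), h, rfl⟩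
    simp only [max_lt_iff] at hij
    rcases hij with hi | hi
    · exact absurd h2 hi.2.1.not_ge
    · exact absurd h3 hi.2.2.not_ge

theorem marking_mem_finSupp (c : ℤ → ZMod 2) (w : FreeGroup ℕ) : marking c w ∈ finSupp c := by
  have of_bound : ∀ (g : ShiftExt c) (b : ℤ), (∀ i, b < |i| → g.fst i = 0) →
      (∀ i j, b < |i| ∨ b < |j| → g.snd i j = 0) → g ∈ finSupp c := by
    intro g b h1 h2
    refine ⟨(Set.finite_Icc (-b) b).subset fun i hi => ?_,
      ((Set.finite_Icc (-b) b).prod (Set.finite_Icc (-b) b)).subset fun p hp => ?_⟩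
    · by_contra h
      rw [Set.mem_Icc, ← abs_le, not_le] at h
      exact hi (h1 i h)
    · by_contra h
      rw [Set.mem_prod, Set.mem_Icc, Set.mem_Icc, ← abs_le, ← abs_le, not_and_or, not_le,
        not_le] at h
      exact hp (h2 _ _ h)
  induction w using marking_induction with
  | one => exact of_bound _ 0 (by simp) (by simp)
  | zero =>
    rw [marking_zero]
    exact of_bound _ 0 (by simp [translation]) (by simp [translation])
  | first =>
    rw [marking_first]
    refine of_bound _ 0 (fun i hi => ?_) (by simp [delta])
    simp [delta, abs_pos.1 hi]
  | triv k hk =>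
    rw [hk]
    exact of_bound _ 0 (by simp) (by simp)
  | inv u hu =>
    obtain ⟨b, h1, h2⟩ := exists_bound_of_mem_finSupp hu
    rw [map_inv]
    have hsub : ∀ i, b + |(marking c u).shift| < |i| → b < |i + (marking c u).shift| := by
      intro i hi
      have := abs_sub_abs_le_abs_sub i (-(marking c u).shift)
      rw [abs_neg, sub_neg_eq_add] at this
      linarith
    refine of_bound _ (b + |(marking c u).shift|) (fun i hi => ?_) (fun i j hij => ?_)
    · simp [h1 _ (hsub i hi)]
    · rcases hij with h | h
      · simp [h2 _ _ (Or.inl (hsub i h)), h1 _ (hsub i h)]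
      · simp [h2 _ _ (Or.inr (hsub j h)), h1 _ (hsub j h)]
  | mul u v hu hv =>
    obtain ⟨b, h1, h2⟩ := exists_bound_of_mem_finSupp hu
    obtain ⟨b', h1', h2'⟩ := exists_bound_of_mem_finSupp hv
    rw [map_mul]
    have hsub : ∀ i, max b (b' + |(marking c u).shift|) < |i| →
        b < |i| ∧ b' < |i - (marking c u).shift| := by
      intro i hi
      rw [max_lt_iff] at hi
      have := abs_sub_abs_le_abs_sub i (marking c u).shift
      exact ⟨hi.1, by linarith⟩
    refine of_bound _ (max b (b' + |(marking c u).shift|)) (fun i hi => ?_) (fun i j hij => ?_)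
    · simp [h1 _ (hsub i hi).1, h1' _ (hsub i hi).2]
    · rcases hij with h | h
      · simp [h2 _ _ (Or.inl (hsub i h).1), h2' _ _ (Or.inl (hsub i h).2), h1 _ (hsub i h).1]
      · simp [h2 _ _ (Or.inr (hsub j h).1), h2' _ _ (Or.inr (hsub j h).2), h1' _ (hsub j h).2]

/-! ### Centralizers -/


/-- Commuting with `g` makes the first component of `h` periodic with period `g.shift`, so by finite
support it vanishes. The cocycle terms then disappear, and the same argument applies to the second
component. -/
theorem eq_one_of_commute {g h : ShiftExt c} (hg : g.shift ≠ 0) (hh : h.shift = 0)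
    (hfin : h ∈ finSupp c) (hc : Commute g h) : h = 1 := by
  obtain ⟨b, hb1, hb2⟩ := exists_bound_of_mem_finSupp hfin
  have large : ∀ i : ℤ, ∃ k : ℕ, b < |i - k * g.shift| := by
    intro i
    refine ⟨(|i| + |b| + 1).toNat, ?_⟩
    have h0 : 0 ≤ |i| + |b| + 1 := by positivity
    rw [Int.toNat_of_nonneg h0, abs_sub_comm]
    have h1 := abs_sub_abs_le_abs_sub ((|i| + |b| + 1) * g.shift) i
    have h2 : (1 : ℤ) ≤ |g.shift| := Int.one_le_abs hg
    rw [abs_mul, abs_of_nonneg h0] at h1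
    have h3 := mul_le_mul_of_nonneg_left h2 h0
    have h4 := le_abs_self b
    linarith
  have hfst : ∀ i, h.fst i = h.fst (i - g.shift) := by
    intro i
    have := congrArg (fun k => k.fst i) hc.eq
    simp only [mul_fst, hh, sub_zero] at this
    linear_combination -this
  have hfst' : ∀ (k : ℕ) i, h.fst i = h.fst (i - k * g.shift) := by
    intro k
    induction k with
    | zero => simp
    | succ k ih =>
      intro i
      rw [ih i, hfst]
      congr 1
      push_cast
      ring
  have hf0 : ∀ i, h.fst i = 0 := by
    intro i
    obtain ⟨k, hk⟩ := large i
    rw [hfst' k, hb1 _ hk]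
  have hsnd : ∀ i j, h.snd i j = h.snd (i - g.shift) (j - g.shift) := by
    intro i j
    have := congrArg (fun k => k.snd i j) hc.eq
    simp only [mul_snd, hh, sub_zero, hf0] at this
    linear_combination -this
  have hsnd' : ∀ (k : ℕ) i j, h.snd i j = h.snd (i - k * g.shift) (j - k * g.shift) := by
    intro k
    induction k with
    | zero => simp
    | succ k ih =>
      intro i j
      rw [ih i j, hsnd]
      congr 1 <;> push_cast <;> ring
  ext i j
  · exact hf0 i
  · obtain ⟨k, hk⟩ := large i
    rw [hsnd' k, hb2 _ _ (Or.inl hk), one_snd]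
  · exact hh

theorem commute_iff_of_shift_eq_zero {g h : ShiftExt c} (hg : g.shift = 0) (hh : h.shift = 0) :
    Commute g h ↔ ∀ i j, c (i - j) * (g.fst i * h.fst j - h.fst i * g.fst j) = 0 := by
  rw [commute_iff_eq, ShiftExt.ext_iff]
  simp only [funext_iff, mul_fst, mul_snd, mul_shift, hg, hh, sub_zero]
  constructor
  · rintro ⟨-, h2, -⟩ i j
    linear_combination h2 i j
  · intro h2
    refine ⟨fun i => add_comm _ _, fun i j => ?_, trivial⟩
    linear_combination h2 i j

/-- The commutator of `h` and `k` has shift zero and commutes with `g`, so `eq_one_of_commute`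
applies to it. -/
theorem commute_of_commute_of_shift_ne_zero {g h k : ShiftExt c} (hg : g.shift ≠ 0)
    (hfin : ⁅h, k⁆ ∈ finSupp c) (hh : Commute g h) (hk : Commute g k) : Commute h k := by
  rw [← commutatorElement_eq_one_iff_commute]
  refine eq_one_of_commute hg ?_ hfin ?_
  · simp [commutatorElement_def]
  · rw [commutatorElement_def]
    exact ((hh.mul_right hk).mul_right hh.inv_right).mul_right hk.inv_right

/-- From the second term on, the elements of a half chain lie in the kernel of the projection to the
group of translations. -/
theorem shift_eq_zero_of_isHalfChain {a y : ℕ → FreeGroup ℕ}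
    (h : IsHalfChain (marking c ∘ a) (marking c ∘ y)) :
    (∀ n, (marking c (a n)).shift = 0) ∧ ∀ n, (marking c (y (n + 1))).shift = 0 := by
  have fin := marking_mem_finSupp c
  have hcomm : ∀ j n, j < n → Commute (marking c (a j)) (marking c (y n)) :=
    fun j n hjn => ((h n).1 j hjn).symm
  have hy1 : ∀ n, marking c (y n) ≠ 1 := fun n e => (h n).2 (by
    simp only [Function.comp_apply, e]
    exact Commute.one_left _)
  have ha1 : ∀ n, marking c (a n) ≠ 1 := fun n e => (h n).2 (by
    simp only [Function.comp_apply, e]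
    exact Commute.one_right _)
  have trans : ∀ g u v : FreeGroup ℕ, (marking c g).shift ≠ 0 →
      Commute (marking c g) (marking c u) → Commute (marking c g) (marking c v) →
      Commute (marking c u) (marking c v) := fun g u v hg hu hv =>
    commute_of_commute_of_shift_ne_zero hg (by
      rw [← map_commutatorElement]
      exact fin _) hu hv
  have ha : ∀ n, (marking c (a n)).shift = 0 := by
    intro j
    by_contra hj
    -- If `a j` moves, then so does `y (j + 2)`, and transitivity of commutation applies twice:
    -- through `a j` to `y (j + 1)` and `y (j + 2)`, then through `y (j + 2)` to `y (j + 1)` and `a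
    -- (j + 1)`, which must not commute.
    have h2 : (marking c (y (j + 2))).shift ≠ 0 := fun e =>
      hy1 _ (eq_one_of_commute hj e (fin _) (hcomm j (j + 2) (by omega)))
    have h3 := trans (a j) (y (j + 2)) (y (j + 1)) hj (hcomm j _ (by omega)) (hcomm j _ (by omega))
    have h4 := (hcomm (j + 1) (j + 2) (by omega)).symm
    exact (h (j + 1)).2 (trans _ _ _ h2 h3 h4)
  refine ⟨ha, fun n => ?_⟩
  by_contra hn
  exact ha1 0 (eq_one_of_commute hn (ha 0) (fin _) (hcomm 0 (n + 1) n.succ_pos).symm)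

/-- A half chain yields an infinite set of integers, all of whose finite subsets have infinitely
many common neighbours. -/
theorem exists_infinite_of_isHalfChain {a y : ℕ → FreeGroup ℕ}
    (h : IsHalfChain (marking c ∘ a) (marking c ∘ y)) :
    ∃ W : Set ℤ, W.Infinite ∧ ∀ F : Set ℤ, F.Finite → F ⊆ W →
      {u | ∀ w ∈ F, c (u - w) = 0}.Infinite := by
  obtain ⟨ha, hy⟩ := shift_eq_zero_of_isHalfChain h
  have fin : ∀ w, (marking c w).fst.support.Finite := fun w => (marking_mem_finSupp c w).1
  have hcomm : ∀ m n, Commute (marking c (y (n + 1))) (marking c (a m)) ↔ _ := fun m n =>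
    commute_iff_of_shift_eq_zero (hy n) (ha m)
  have congr_a : ∀ m m' n, (marking c (a m)).fst = (marking c (a m')).fst →
      Commute (marking c (y (n + 1))) (marking c (a m)) →
      Commute (marking c (y (n + 1))) (marking c (a m')) := by
    intro m m' n e hm
    rw [hcomm] at hm ⊢
    rwa [← e]
  have congr_y : ∀ m n n', (marking c (y (n + 1))).fst = (marking c (y (n' + 1))).fst →
      Commute (marking c (y (n + 1))) (marking c (a m)) →
      Commute (marking c (y (n' + 1))) (marking c (a m)) := by
    intro m n n' e hm
    rw [hcomm] at hm ⊢
    rwa [← e]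
  have finite_functions : ∀ s : Set ℤ, s.Finite → {f : ℤ → ZMod 2 | f.support ⊆ s}.Finite := by
    intro s hs
    have : Finite s := hs
    refine Set.Finite.of_finite_image (f := fun f (i : s) => f i) (Set.toFinite _) ?_
    intro f hf g hg e
    funext i
    by_cases hi : i ∈ s
    · exact congrFun e ⟨i, hi⟩
    · rw [Function.notMem_support.1 fun h => hi (hf h), Function.notMem_support.1 fun h => hi (hg h)]
  -- Were the union of supports finite, two of the `a (n + 1)` would have the same first component,
  -- hence the same commutation with every `y (k + 1)`. The indices start at one because `y 0` may
  -- have nonzero shift.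
  refine ⟨⋃ n, (marking c (a n)).fst.support, fun hW => ?_, fun F hF hFW => ?_⟩
  · obtain ⟨m, -, n, -, hmn, e⟩ := Set.infinite_univ.exists_ne_map_eq_of_mapsTo
      (f := fun n => (marking c (a (n + 1))).fst)
      (fun n _ => Set.subset_iUnion (fun n => (marking c (a n)).fst.support) (n + 1))
      (finite_functions _ hW)
    wlog hlt : m < n generalizing m n
    · exact this n m hmn.symm e.symm (by omega)
    exact (h (n + 1)).2 (congr_a _ _ _ e ((h (n + 1)).1 (m + 1) (by omega)))
  · obtain ⟨m, hm⟩ : ∃ m, F ⊆ ⋃ j ∈ Set.Iio m, (marking c (a j)).fst.support := by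
      have hex : ∀ w, ∃ n, w ∈ F → w ∈ (marking c (a n)).fst.support := by
        intro w
        by_cases hw : w ∈ F
        · obtain ⟨n, hn⟩ := Set.mem_iUnion.1 (hFW hw)
          exact ⟨n, fun _ => hn⟩
        · exact ⟨0, fun h => absurd h hw⟩
      choose f hf using hex
      obtain ⟨b, hb⟩ := (hF.image f).bddAbove
      exact ⟨b + 1, fun w hw => Set.mem_iUnion₂.2
        ⟨f w, Nat.lt_succ_of_le (hb ⟨w, hw, rfl⟩), hf w hw⟩⟩
    have hU : (⋃ n, (marking c (y (m + n + 1))).fst.support).Infinite := by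
      intro hU
      obtain ⟨k, -, n, -, hkn, e⟩ := Set.infinite_univ.exists_ne_map_eq_of_mapsTo
        (f := fun n => (marking c (y (m + n + 1))).fst)
        (fun n _ => Set.subset_iUnion (fun n => (marking c (y (m + n + 1))).fst.support) n)
        (finite_functions _ hU)
      wlog hlt : k < n generalizing k n
      · exact this n k hkn.symm e.symm (by omega)
      exact (h (m + k + 1)).2 (congr_y _ _ _ e.symm ((h (m + n + 1)).1 (m + k + 1) (by omega)))
    have hX : (⋃ j ∈ Set.Iio m, (marking c (a j)).fst.support).Finite :=
      (Set.finite_Iio m).biUnion fun j _ => fin _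
    -- At a point `u` of the support of a late `y` outside the supports of the relevant `a j`, one
    -- of the two terms of the commutation form vanishes, which forces `c (u - w) = 0`.
    refine (hU.sdiff hX).mono ?_
    rintro u ⟨hu, huX⟩ w hw
    obtain ⟨n, hn⟩ := Set.mem_iUnion.1 hu
    obtain ⟨j, hj, hjw⟩ := Set.mem_iUnion₂.1 (hm hw)
    have huj : (marking c (a j)).fst u = 0 := by
      by_contra hne
      exact huX (Set.mem_iUnion₂.2 ⟨j, hj, hne⟩)
    have := (hcomm j (m + n)).1 ((h (m + n + 1)).1 j (by
      have := Set.mem_Iio.1 hj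
      omega)) u w
    rw [huj, zero_mul, sub_zero] at this
    exact (mul_eq_zero.1 this).resolve_right (mul_ne_zero hn hjw)

/-- The commutation form of two delta functions is supported at `(i, j)` and `(j, i)`; by `hc` both
coefficients vanish together. -/
theorem commute_delta_iff {i j : ℤ} (hij : i ≠ j) (hc : c (i - j) = c (j - i)) :
    Commute (delta i : ShiftExt c) (delta j) ↔ c (i - j) = 0 := by
  rw [commute_iff_of_shift_eq_zero rfl rfl]
  constructor
  · intro h
    simpa [delta, Pi.single_apply, hij] using h i j
  · intro h i' j'
    have off : ∀ k l : ℤ, ¬ (i' = k ∧ j' = l) →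
        (Pi.single k 1 : ℤ → ZMod 2) i' * (Pi.single l 1 : ℤ → ZMod 2) j' = 0 := by
      intro k l hkl
      rcases not_and_or.1 hkl with hk | hl
      · rw [Pi.single_eq_of_ne hk, zero_mul]
      · rw [Pi.single_eq_of_ne hl, mul_zero]
    by_cases h1 : i' = i ∧ j' = j
    · rw [h1.1, h1.2, h, zero_mul]
    by_cases h2 : i' = j ∧ j' = i
    · rw [h2.1, h2.2, ← hc, h, zero_mul]
    simp only [delta, off i j h1, off j i h2, sub_zero, mul_zero]

end ShiftExt

/-! ### Differences of powers of four -/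

theorem four_mul_four_pow_le {a b : ℕ} (h : b < a) : 4 * (4 : ℤ) ^ b ≤ 4 ^ a := by
  rw [← pow_succ']
  exact pow_le_pow_right₀ (by norm_num) h

/-- Both `4 ^ b'` and `4 ^ a` are at most a quarter of `4 ^ a'`, so at least half of it survives.
This gap separates differences with distinct leading exponents. -/
theorem four_pow_sub_gap {a b a' b' : ℕ} (hb' : b' < a') (h : a < a') :
    (4 : ℤ) ^ a' ≤ 2 * ((4 ^ a' - 4 ^ b') - (4 ^ a - 4 ^ b)) := by
  have h1 := four_mul_four_pow_le hb'
  have h2 := four_mul_four_pow_le h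
  have h3 : (0 : ℤ) < 4 ^ b := by positivity
  linarith

theorem four_pow_injective {a b : ℕ} (h : (4 : ℤ) ^ a = 4 ^ b) : a = b :=
  pow_right_injective₀ (by norm_num) (by norm_num) h

theorem four_pow_sub_inj_of_lt {a b a' b' : ℕ} (hb : b < a) (hb' : b' < a')
    (h : (4 : ℤ) ^ a - 4 ^ b = 4 ^ a' - 4 ^ b') : a = a' ∧ b = b' := by
  have h1 : (0 : ℤ) < 4 ^ a := by positivity
  have h2 : (0 : ℤ) < 4 ^ a' := by positivity
  obtain rfl : a = a' := by
    rcases lt_trichotomy a a' with hlt | rfl | hlt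
    · have := four_pow_sub_gap (b := b) hb' hlt
      linarith
    · rfl
    · have := four_pow_sub_gap (b := b') hb hlt
      linarith
  exact ⟨rfl, four_pow_injective (by linarith)⟩

theorem four_pow_sub_inj {a b a' b' : ℕ} (hab : a ≠ b)
    (h : (4 : ℤ) ^ a - 4 ^ b = 4 ^ a' - 4 ^ b') : a = a' ∧ b = b' := by
  have lt_iff : ∀ a b : ℕ, b < a ↔ (0 : ℤ) < 4 ^ a - 4 ^ b := fun a b => by
    rw [sub_pos, pow_lt_pow_iff_right₀ (by norm_num)]
  rcases hab.lt_or_gt with hlt | hlt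
  · have hlt' : a' < b' := by
      rw [lt_iff] at hlt ⊢
      linarith
    exact (four_pow_sub_inj_of_lt hlt hlt' (by linarith)).symm
  · have hlt' : b' < a' := by
      rw [lt_iff] at hlt ⊢
      linarith
    exact four_pow_sub_inj_of_lt hlt hlt' h

theorem encode_le_encode_of_suffix {s t : List ℕ} (h : s <:+ t) :
    Encodable.encode s ≤ Encodable.encode t := by
  obtain ⟨l, rfl⟩ := h
  induction l with
  | nil => exact le_rfl
  | cons a l ih =>
    rw [List.cons_append, Encodable.encode_list_cons]
    exact ih.trans ((Nat.right_le_pair _ _).trans (Nat.le_succ _))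

namespace SeqTree

/-! ### The commutation pattern of a tree -/

/-- `s` is an initial segment of `t`, and all initial segments of `t` lie in `T`. Finite sequences
are written in reverse order. -/
def Related (T : List ℕ → Bool) (s t : List ℕ) : Prop :=
  s <:+ t ∧ ∀ r, r <:+ t → T r = true

/-- The place of a finite sequence in its role as an initial segment. -/
def lo (s : List ℕ) : ℤ := 4 ^ (2 * Encodable.encode s)

/-- The place of a finite sequence in its role as an extension. -/
def hi (t : List ℕ) : ℤ := 4 ^ (2 * Encodable.encode t + 1)

open Classical in
/-- The commutation pattern of a tree: delta functions commute if their distance is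
`hi t - lo s` for related `s` and `t`. -/
noncomputable def coeff (T : List ℕ → Bool) (d : ℤ) : ZMod 2 :=
  if ∃ s t, Related T s t ∧ |d| = hi t - lo s then 0 else 1

theorem coeff_eq_zero_iff {T : List ℕ → Bool} {d : ℤ} :
    coeff T d = 0 ↔ ∃ s t, Related T s t ∧ |d| = hi t - lo s := by
  rw [coeff]
  split_ifs with h <;> simp [h]

theorem coeff_neg (T : List ℕ → Bool) (d : ℤ) : coeff T (-d) = coeff T d := by
  rw [coeff, coeff, abs_neg]

theorem measurable_coeff : Measurable coeff := by
  classical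
  refine measurable_pi_lambda _ fun d => Measurable.ite ?_ measurable_const measurable_const
  have h : ∀ s t, MeasurableSet {T : List ℕ → Bool | Related T s t} := by
    intro s t
    have e : {T : List ℕ → Bool | Related T s t} =
        {_T | s <:+ t} ∩ ⋂ r, {_T | r <:+ t}ᶜ ∪ {T | T r = true} := by
      ext T
      simp [Related, imp_iff_not_or]
    rw [e]
    exact (MeasurableSet.const _).inter (MeasurableSet.iInter fun r =>
      (MeasurableSet.const _).compl.union
        (measurableSet_eq_fun (measurable_pi_apply r) measurable_const))
  have e : {T : List ℕ → Bool | ∃ s t, Related T s t ∧ |d| = hi t - lo s} =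
      ⋃ s, ⋃ t, {T | Related T s t} ∩ {_T | |d| = hi t - lo s} := by
    ext T
    simp
  rw [e]
  exact MeasurableSet.iUnion fun s => MeasurableSet.iUnion fun t =>
    (h s t).inter (MeasurableSet.const _)

theorem lo_injective : Function.Injective lo := by
  intro s s' h
  have := four_pow_injective h
  exact Encodable.encode_injective (by omega)

theorem lo_ne_hi (s t : List ℕ) : lo s ≠ hi t := by
  intro h
  have := four_pow_injective h
  omega

/-- Differences of powers of four determine the exponents; the parity of the exponents rules out the
opposite sign. -/
theorem coeff_hi_sub_lo {T : List ℕ → Bool} {s t : List ℕ} :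
    coeff T (hi t - lo s) = 0 ↔ Related T s t := by
  rw [coeff_eq_zero_iff]
  constructor
  · rintro ⟨s', t', h, e⟩
    rcases abs_choice (hi t - lo s) with h' | h'
    · rw [h'] at e
      obtain ⟨h1, h2⟩ := four_pow_sub_inj (by omega) e
      obtain rfl : t = t' := Encodable.encode_injective (by omega)
      obtain rfl : s = s' := Encodable.encode_injective (by omega)
      exact h
    · rw [h', neg_sub] at e
      have := (four_pow_sub_inj (by omega) e).1
      omega
  · intro h
    refine ⟨s, t, h, abs_of_nonneg (sub_nonneg.2 ?_)⟩
    have := encode_le_encode_of_suffix h.1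
    exact pow_le_pow_right₀ (by norm_num) (by omega)

theorem exponent_lt_exponent {T : List ℕ → Bool} {s t : List ℕ} (h : Related T s t) :
    2 * Encodable.encode s < 2 * Encodable.encode t + 1 := by
  have := encode_le_encode_of_suffix h.1
  omega

/-! ### From common neighbours to a branch -/

theorem res_eq_reverse (x : ℕ → ℕ) (n : ℕ) : PiNat.res x n = ((List.range n).map x).reverse := by
  induction n with
  | zero => rfl
  | succ n ih => simp [PiNat.res_succ, ih, List.range_succ]

/-- Two initial segments of one sequence are comparable, so `B` is a chain with members of unbounded
length, and their union is a branch. -/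
theorem mem_illFounded_of_infinite {T : List ℕ → Bool} {B : Set (List ℕ)} (hB : B.Infinite)
    (h : ∀ s ∈ B, ∀ s' ∈ B, ∃ t, Related T s t ∧ Related T s' t) : T ∈ illFounded := by
  have comparable : ∀ s ∈ B, ∀ s' ∈ B, s <:+ s' ∨ s' <:+ s := by
    intro s hs s' hs'
    obtain ⟨t, h1, h2⟩ := h s hs s' hs'
    exact List.suffix_or_suffix_of_suffix h1.1 h2.1
  have long : ∀ n, ∃ s ∈ B, n < s.length := by
    intro n
    by_contra! hn
    have hinj : Set.InjOn List.length B := by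
      intro s hs s' hs' e
      rcases comparable s hs s' hs' with h | h
      · exact h.eq_of_length e
      · exact (h.eq_of_length e.symm).symm
    exact hB (Set.Finite.of_finite_image
      ((Set.finite_Iic n).subset (Set.image_subset_iff.2 fun s hs => hn s hs)) hinj)
  choose S hS hlen using long
  let x : ℕ → ℕ := fun n => (S n).reverse[n]'(by simpa using hlen n)
  have hx : ∀ s ∈ B, ∀ n (hn : n < s.reverse.length), s.reverse[n] = x n := by
    intro s hs n hn
    rcases comparable s hs (S n) (hS n) with h | h
    · exact (List.reverse_prefix.2 h).getElem hn
    · exact ((List.reverse_prefix.2 h).getElem _).symm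
  refine ⟨x, fun n => ?_⟩
  have e : (List.range n).map x = (S n).reverse.take n := by
    apply List.ext_getElem
    · simpa using (hlen n).le
    · intro i h1 h2
      have hi : i < (S n).reverse.length := by
        have := hlen n
        simp only [List.length_map, List.length_range] at h1
        simp only [List.length_reverse]
        omega
      rw [List.getElem_take, hx _ (hS n) i hi]
      simp
  obtain ⟨t, ht, -⟩ := h _ (hS n) _ (hS n)
  refine ht.2 _ (List.IsSuffix.trans ?_ ht.1)
  rw [res_eq_reverse, e, ← List.reverse_prefix, List.reverse_reverse]
  exact List.take_prefix _ _

/-- The elements of a finite set with sufficiently large common neighbours come from initial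
segments of one and the same sequence. -/
theorem exists_common_extension {T : List ℕ → Bool} {F : Set ℤ} (hF : F.Finite)
    (h : ∀ M, ∃ u > M, ∀ w ∈ F, coeff T (u - w) = 0) :
    ∃ u t, ∀ w ∈ F, ∃ s, Related T s t ∧ u - w = hi t - lo s := by
  obtain ⟨b, hb⟩ := (hF.image fun w => |w|).bddAbove
  have hb' : ∀ w ∈ F, |w| ≤ b := fun w hw => hb ⟨w, hw, rfl⟩
  -- If the sequences `t` and `t'` of two points of `F` had different codes, `four_pow_sub_gap`
  -- would bound the larger place `hi` by twice a difference of two points, so by `4 * |b|`. But it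
  -- exceeds `u - w'`, hence `4 * |b|`.
  obtain ⟨u, hu, hw⟩ := h (5 * |b| + 1)
  have hba := le_abs_self b
  have key : ∀ w ∈ F, ∃ s t, Related T s t ∧ u - w = hi t - lo s := by
    intro w hwF
    obtain ⟨s, t, hst, e⟩ := coeff_eq_zero_iff.1 (hw w hwF)
    have h1 := abs_le.1 (hb' w hwF)
    exact ⟨s, t, hst, by rw [← e, abs_of_nonneg (by linarith [h1.2, abs_nonneg b])]⟩
  have uniq : ∀ w ∈ F, ∀ w' ∈ F, ∀ s t s' t', Related T s t → u - w = hi t - lo s →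
      Related T s' t' → u - w' = hi t' - lo s' →
      ¬ 2 * Encodable.encode t + 1 < 2 * Encodable.encode t' + 1 := by
    intro w hwF w' hwF' s t s' t' hst e hst' e' hlt
    have h1 := abs_le.1 (hb' w hwF)
    have h2 := abs_le.1 (hb' w' hwF')
    have h3 := four_pow_sub_gap (b := 2 * Encodable.encode s) (exponent_lt_exponent hst') hlt
    have h4 : (0 : ℤ) < 4 ^ (2 * Encodable.encode s') := by positivity
    simp only [hi, lo] at e e'
    linarith [h1.1, h1.2, h2.1, h2.2]
  rcases F.eq_empty_or_nonempty with rfl | ⟨w₀, hw₀⟩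
  · exact ⟨0, [], by simp⟩
  obtain ⟨s₀, t₀, hst₀, e₀⟩ := key w₀ hw₀
  refine ⟨u, t₀, fun w hwF => ?_⟩
  obtain ⟨s, t, hst, e⟩ := key w hwF
  have h1 := uniq _ hw₀ _ hwF _ _ _ _ hst₀ e₀ hst e
  have h2 := uniq _ hwF _ hw₀ _ _ _ _ hst e hst₀ e₀
  obtain rfl : t = t₀ := Encodable.encode_injective (by omega)
  exact ⟨s, hst, e⟩

/-- The translation that carries a finite subset to places `lo s` could depend on the subset.
Including two fixed points `w₀` and `w₁` pins it down, since the difference of their places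
determines both places. -/
theorem mem_illFounded_of_large_neighbours {T : List ℕ → Bool} {W : Set ℤ} (hW : W.Infinite)
    (h : ∀ F : Set ℤ, F.Finite → F ⊆ W → ∀ M, ∃ u > M, ∀ w ∈ F, coeff T (u - w) = 0) :
    T ∈ illFounded := by
  have ext : ∀ F : Set ℤ, F.Finite → F ⊆ W → _ := fun F hF hFW =>
    exists_common_extension hF (h F hF hFW)
  obtain ⟨w₀, hw₀, w₁, hw₁, hne⟩ := hW.nontrivial
  obtain ⟨u, t, hut⟩ := ext {w₀, w₁} (Set.toFinite _) (Set.insert_subset hw₀ (by simpa using hw₁))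
  obtain ⟨σ₀, -, e₀⟩ := hut w₀ (by simp)
  obtain ⟨σ₁, -, e₁⟩ := hut w₁ (by simp)
  have common : ∀ w ∈ W, ∀ w' ∈ W, ∃ s s' t, lo s = w - w₀ + lo σ₀ ∧ lo s' = w' - w₀ + lo σ₀ ∧
      Related T s t ∧ Related T s' t := by
    intro w hw w' hw'
    obtain ⟨u', t', hut'⟩ := ext {w₀, w₁, w, w'} (Set.toFinite _) (by
      rintro v (rfl | rfl | rfl | rfl) <;> assumption)
    obtain ⟨s₀, -, e₀'⟩ := hut' w₀ (by simp)
    obtain ⟨s₁, -, e₁'⟩ := hut' w₁ (by simp)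
    obtain ⟨s, hs, e⟩ := hut' w (by simp)
    obtain ⟨s', hs', e'⟩ := hut' w' (by simp)
    have hne' : σ₀ ≠ σ₁ := by
      rintro rfl
      exact hne (by linarith)
    have hσ : lo σ₀ - lo σ₁ = lo s₀ - lo s₁ := by linarith
    have := (four_pow_sub_inj (fun h => hne' (Encodable.encode_injective (by omega))) hσ).1
    obtain rfl : σ₀ = s₀ := Encodable.encode_injective (by omega)
    exact ⟨s, s', t', by linarith, by linarith, hs, hs'⟩
  refine mem_illFounded_of_infinite (B := {s | ∃ w ∈ W, lo s = w - w₀ + lo σ₀}) ?_ ?_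
  · intro hfin
    refine hW ((hfin.image fun s => lo s + w₀ - lo σ₀).subset fun w hw => ?_)
    obtain ⟨s, -, -, hs, -⟩ := common w hw w hw
    exact ⟨s, ⟨w, hw, hs⟩, by simp only [hs]; ring⟩
  · rintro s ⟨w, hw, hs⟩ s' ⟨w', hw', hs'⟩
    obtain ⟨r, r', t, hr, hr', h1, h2⟩ := common w hw w' hw'
    obtain rfl := lo_injective (hs.trans hr.symm)
    obtain rfl := lo_injective (hs'.trans hr'.symm)
    exact ⟨t, h1, h2⟩

theorem mem_illFounded_of_infinite_neighbours {T : List ℕ → Bool} {W : Set ℤ} (hW : W.Infinite)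
    (h : ∀ F : Set ℤ, F.Finite → F ⊆ W → {u | ∀ w ∈ F, coeff T (u - w) = 0}.Infinite) :
    T ∈ illFounded := by
  by_cases hpos : ∀ F : Set ℤ, F.Finite → F ⊆ W → ∀ M, ∃ u > M, ∀ w ∈ F, coeff T (u - w) = 0
  · exact mem_illFounded_of_large_neighbours hW hpos
  push Not at hpos
  obtain ⟨F₀, hF₀, hFW₀, M₀, hM₀⟩ := hpos
  -- The common neighbours of `F₀` are bounded above. Adjoining `F₀` to any finite set thus forces
  -- the infinitely many common neighbours to be unbounded below, and `coeff T` is even, so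
  -- reflection reduces to the previous case.
  refine mem_illFounded_of_large_neighbours (W := Neg.neg '' W)
    (hW.image neg_injective.injOn) fun F hF hFW M => ?_
  have hsub : F₀ ∪ Neg.neg '' F ⊆ W := by
    refine Set.union_subset hFW₀ ?_
    rintro _ ⟨w, hw, rfl⟩
    obtain ⟨v, hv, rfl⟩ := hFW hw
    simpa using hv
  have hinf := h _ (hF₀.union (hF.image _)) hsub
  by_contra! hM
  refine hinf ((Set.finite_Icc (-M) M₀).subset fun u hu => ⟨?_, ?_⟩)
  · by_contra hlt
    obtain ⟨w, hw, hne⟩ := hM (-u) (by linarith [not_le.1 hlt])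
    refine hne ?_
    rw [← coeff_neg]
    have := hu (-w) (Or.inr ⟨w, hw, rfl⟩)
    rwa [show -(-u - w) = u - -w by ring]
  · by_contra hlt
    obtain ⟨w, hw, hne⟩ := hM₀ u (not_le.1 hlt)
    exact hne (hu w (Or.inl hw))

/-! ### The marked group of a tree -/

/-- The finitely generated marked group attached to a set of finite sequences. -/
noncomputable def toMarked (T : List ℕ → Bool) : MarkedGroup := ShiftExt.toMarked (coeff T)

theorem measurable_toMarked : Measurable toMarked :=
  ShiftExt.measurable_toMarked.comp measurable_coeff

theorem commute_hi_lo_iff {T : List ℕ → Bool} {s t : List ℕ} :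
    Commute (QuotientGroup.mk (ShiftExt.deltaWord (hi t)) : (toMarked T).Carrier)
      (QuotientGroup.mk (ShiftExt.deltaWord (lo s))) ↔ Related T s t := by
  rw [MarkedGroup.commute_mk_iff, toMarked, ShiftExt.commutator_mem_toMarked_ker,
    ShiftExt.marking_deltaWord, ShiftExt.marking_deltaWord,
    ShiftExt.commute_delta_iff (lo_ne_hi s t).symm, coeff_hi_sub_lo]
  rw [← coeff_neg, neg_sub]

theorem notMem_classMC_iff {T : List ℕ → Bool} :
    toMarked T ∉ MarkedGroup.classMC ↔ T ∈ illFounded := by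
  constructor
  · intro h
    obtain ⟨a, y, h⟩ := (MarkedGroup.notMem_classMC_iff _).1 h
    have hc : IsHalfChain (ShiftExt.marking (coeff T) ∘ a) (ShiftExt.marking (coeff T) ∘ y) :=
      fun n => ⟨fun j hj => ShiftExt.commutator_mem_toMarked_ker.1 ((h n).1 j hj),
        fun hn => (h n).2 (ShiftExt.commutator_mem_toMarked_ker.2 hn)⟩
    obtain ⟨W, hW, hWF⟩ := ShiftExt.exists_infinite_of_isHalfChain hc
    exact mem_illFounded_of_infinite_neighbours hW hWF
  · rintro ⟨x, hx⟩
    have suffix_res : ∀ n (r : List ℕ), r <:+ PiNat.res x n → T r = true := by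
      intro n
      induction n with
      | zero =>
        intro r hr
        obtain rfl : r = [] := List.suffix_nil.1 hr
        exact hx 0
      | succ n ih =>
        intro r hr
        rw [PiNat.res_succ, List.suffix_cons_iff] at hr
        rcases hr with rfl | hr
        · exact hx (n + 1)
        · exact ih r hr
    have res_suffix : ∀ m n, m ≤ n → PiNat.res x m <:+ PiNat.res x n := by
      intro m n hmn
      induction n, hmn using Nat.le_induction with
      | base => exact List.suffix_rfl
      | succ n _ ih => exact ih.trans (List.suffix_cons _ _)
    rw [MarkedGroup.notMem_classMC_iff]
    -- The shift by one makes commutation strict: the segment of length `j + 1` is an initial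
    -- segment of the one of length `n` exactly when `j < n`.
    refine ⟨fun n => ShiftExt.deltaWord (lo (PiNat.res x (n + 1))),
      fun n => ShiftExt.deltaWord (hi (PiNat.res x n)), fun n => ⟨fun j hj => ?_, ?_⟩⟩
    · exact (MarkedGroup.commute_mk_iff _ _ _).1
        (commute_hi_lo_iff.2 ⟨res_suffix _ _ hj, suffix_res n⟩)
    · intro hn
      have := (commute_hi_lo_iff.1 ((MarkedGroup.commute_mk_iff _ _ _).2 hn)).1.length_le
      simp at this

end SeqTree

namespace MarkedGroup

theorem not_measurableSet_classMC_finGen :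
    ¬ MeasurableSet {N : finGen | (N : MarkedGroup) ∈ classMC} := by
  intro h
  let f : (List ℕ → Bool) → finGen := fun T =>
    ⟨SeqTree.toMarked T, ShiftExt.toMarked_mem_finGen _⟩
  have hf : Measurable f := SeqTree.measurable_toMarked.subtype_mk
  refine SeqTree.not_measurableSet_illFounded ?_
  have e : SeqTree.illFounded = (f ⁻¹' {N : finGen | (N : MarkedGroup) ∈ classMC})ᶜ := by
    ext T
    exact SeqTree.notMem_classMC_iff.symm
  rw [e]
  exact (hf h).compl

/-! ### The centralizer rank -/

theorem isWF_centralizerTree {G : Type*} [Group G] (hG : MinCentralizers G) (g : ℕ → G) :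
    SeqTree.IsWF (centralizerTree g) := by
  rintro ⟨x, hx⟩
  refine not_minCentralizers_iff.2 ?_ hG
  have hex : ∀ n, ∃ y, (∀ j < n, Commute y (g (x j))) ∧ ¬ Commute y (g (x n)) := by
    intro n
    have hn : IsCentralizerNode g ((List.range (n + 1)).map x) := hx (n + 1)
    rw [List.range_succ, List.map_append, List.map_singleton] at hn
    have hne : Subgroup.centralizer (seqSet g ((List.range n).map x) ∪ {g (x n)}) ≠
        Subgroup.centralizer (seqSet g ((List.range n).map x)) := by
      generalize e : (List.range n).map x ++ [x n] = t at hn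
      cases hn with
      | nil => simp at e
      | snoc s i hs hi =>
        obtain ⟨rfl, e'⟩ := List.append_inj' e rfl
        rw [List.singleton_inj] at e'
        rwa [e']
    by_contra! hall
    refine hne (le_antisymm (Subgroup.centralizer_le Set.subset_union_left) fun y hy => ?_)
    have hcomm : ∀ j < n, Commute y (g (x j)) := fun j hj =>
      (Subgroup.mem_centralizer_iff.1 hy _
        ⟨x j, List.mem_map.2 ⟨j, List.mem_range.2 hj, rfl⟩, rfl⟩).symm
    rw [Subgroup.mem_centralizer_iff]
    rintro z (hz | rfl)
    · exact Subgroup.mem_centralizer_iff.1 hy z hz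
    · exact (hall y hcomm).eq.symm
  choose y hy using hex
  exact ⟨fun n => g (x n), y, hy⟩

end MarkedGroup

namespace SeqTree

/-- There are only countably many finite sequences, so each rank is a countable supremum of
countable ordinals. -/
theorem nodeRank_lt_omega_one {T : Descriptive.tree ℕ} (hT : IsWF T) (t : T) :
    nodeRank hT t < ω₁ := by
  induction t using hT.wellFounded.induction with
  | _ t ih =>
    rw [nodeRank, Acc.rank_eq]
    refine Ordinal.iSup_lt_omega_one fun b => ?_
    exact (Cardinal.isSuccLimit_omega 1).succ_lt (ih b.1 b.2)

theorem rank_lt_omega_one {T : Descriptive.tree ℕ} (hT : IsWF T) : rank T < ω₁ := by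
  rw [rank, dif_pos hT]
  split_ifs
  · exact (Cardinal.isSuccLimit_omega 1).succ_lt (nodeRank_lt_omega_one hT _)
  · exact Ordinal.omega_pos 1

theorem nodeRank_lt_nodeRank {T : Descriptive.tree ℕ} (hT : IsWF T) {s t : T}
    (h : ProperExt T s t) : nodeRank hT s < nodeRank hT t :=
  Acc.rank_lt_of_rel _ h

/-! ### Trees of descending sequences of ordinals -/

open Classical in
/-- The tree of descending sequences in a linear order, coded by an injection `ι` into the natural
numbers. Sequences are written in reverse order. -/
noncomputable def descending {A : Type*} [LinearOrder A] (ι : A → ℕ) (l : List ℕ) : Bool :=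
  decide (∃ m : List A, m.Pairwise (· < ·) ∧ l = m.map ι)

open Classical in
theorem descending_eq_true_of_suffix {A : Type*} [LinearOrder A] {ι : A → ℕ} {m : List A}
    (hm : m.Pairwise (· < ·)) {r : List ℕ} (hr : r <:+ m.map ι) : descending ι r = true := by
  obtain ⟨m', hm', rfl⟩ := List.suffix_map_iff.1 hr
  exact decide_eq_true ⟨m', hm.sublist hm'.sublist, rfl⟩

open Classical in
theorem descending_notMem_illFounded {A : Type*} [LinearOrder A] [WellFoundedLT A] {ι : A → ℕ}
    (hι : Function.Injective ι) : descending ι ∉ illFounded := by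
  rintro ⟨x, hx⟩
  have hex : ∀ n, ∃ b, ι b = x n := by
    intro n
    obtain ⟨m, -, hm⟩ := of_decide_eq_true (hx (n + 1))
    rw [PiNat.res_succ] at hm
    have : x n ∈ m.map ι := hm ▸ List.mem_cons_self
    obtain ⟨b, -, hb⟩ := List.mem_map.1 this
    exact ⟨b, hb⟩
  choose b hb using hex
  refine (RelEmbedding.natGT (r := (· < ·)) b fun n => ?_).not_wellFounded wellFounded_lt
  obtain ⟨m, hm, e⟩ := of_decide_eq_true (hx (n + 2))
  rw [PiNat.res_succ, PiNat.res_succ, ← hb, ← hb] at e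
  match m, hm, e with
  | [], _, e => simp at e
  | [_], _, e => simp at e
  | c :: d :: m, hm, e =>
    simp only [List.map_cons, List.cons.injEq] at e
    rw [hι e.1, hι e.2.1]
    exact List.rel_of_pairwise_cons hm List.mem_cons_self

/-- The initial segments of a descending sequence, as a node of a centralizer tree. -/
def nodeOf {A : Type*} (idx : List ℕ → ℕ) (ι : A → ℕ) : List A → List ℕ
  | [] => []
  | a :: m => nodeOf idx ι m ++ [idx ((a :: m).map ι)]

theorem mem_nodeOf {A : Type*} {idx : List ℕ → ℕ} {ι : A → ℕ} {m : List A} {i : ℕ}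
    (h : i ∈ nodeOf idx ι m) : ∃ r, r <:+ m.map ι ∧ i = idx r := by
  induction m with
  | nil => simp [nodeOf] at h
  | cons a m ih =>
    rw [nodeOf, List.mem_append, List.mem_singleton] at h
    rcases h with h | h
    · obtain ⟨r, hr, e⟩ := ih h
      exact ⟨r, hr.trans (List.suffix_cons _ _), e⟩
    · exact ⟨_, List.suffix_rfl, h⟩

/-- The delta function at `hi` of the current sequence commutes with those at `lo` of all its
initial segments, but not with the one at `lo` of a longer sequence. Each step thus changes the
centralizer. -/
theorem isCentralizerNode_nodeOf {A : Type*} [LinearOrder A] {ι : A → ℕ}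
    {g : ℕ → (toMarked (descending ι)).Carrier} {idx : List ℕ → ℕ}
    (hidx : ∀ s, g (idx s) = QuotientGroup.mk (ShiftExt.deltaWord (lo s))) {m : List A}
    (hm : m.Pairwise (· < ·)) : IsCentralizerNode g (nodeOf idx ι m) := by
  induction m with
  | nil => exact .nil
  | cons a m ih =>
    have hm' := (List.pairwise_cons.1 hm).2
    refine .snoc _ _ (ih hm') fun e => ?_
    have hmem : (QuotientGroup.mk (ShiftExt.deltaWord (hi (m.map ι))) :
        (toMarked (descending ι)).Carrier) ∈
          Subgroup.centralizer (seqSet g (nodeOf idx ι m)) := by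
      rw [Subgroup.mem_centralizer_iff]
      rintro _ ⟨i, hi, rfl⟩
      obtain ⟨r, hr, rfl⟩ := mem_nodeOf hi
      rw [hidx]
      exact (commute_hi_lo_iff.2 ⟨hr, fun r' hr' => descending_eq_true_of_suffix hm' hr'⟩).eq.symm
    rw [← e, Subgroup.mem_centralizer_iff] at hmem
    have h := hmem _ (Or.inr rfl)
    rw [hidx] at h
    have := (commute_hi_lo_iff.1 (Commute.symm h)).1.length_le
    simp at this

/-- A descending sequence with all entries at least `β` can be extended by any `γ < β`, and by
induction the extension has rank at least `γ`. -/
theorem le_nodeRank_nodeOf {α : Ordinal.{0}} {ι : Set.Iio α → ℕ}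
    {g : ℕ → (toMarked (descending ι)).Carrier} {idx : List ℕ → ℕ}
    (hidx : ∀ s, g (idx s) = QuotientGroup.mk (ShiftExt.deltaWord (lo s)))
    (hT : IsWF (centralizerTree g)) (β : Ordinal.{0}) (hβ : β ≤ α) {m : List (Set.Iio α)}
    (hm : m.Pairwise (· < ·)) (hmβ : ∀ b ∈ m, β ≤ b) :
    β ≤ nodeRank hT ⟨nodeOf idx ι m, isCentralizerNode_nodeOf hidx hm⟩ := by
  induction β using WellFoundedLT.induction generalizing m with
  | _ β ih =>
    refine le_of_forall_lt fun γ hγ => ?_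
    let b : Set.Iio α := ⟨γ, hγ.trans_le hβ⟩
    have hm' : (b :: m).Pairwise (· < ·) :=
      List.pairwise_cons.2 ⟨fun c hc => hγ.trans_le (hmβ c hc), hm⟩
    refine (ih γ hγ (hγ.le.trans hβ) hm' ?_).trans_lt (nodeRank_lt_nodeRank hT ?_)
    · intro c hc
      rcases List.mem_cons.1 hc with rfl | hc
      · exact le_rfl
      · exact hγ.le.trans (hmβ c hc)
    · refine ⟨List.prefix_append _ _, fun e => ?_⟩
      have := congrArg List.length e
      simp [nodeOf] at this

end SeqTree

namespace MarkedGroup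

theorem exists_le_centralizerRank {γ : ℕ → FreeGroup ℕ} (hγ : Function.Surjective γ)
    {α : Ordinal.{0}} (hα : α < ω₁) : ∃ N ∈ classMC ∩ finGen, α ≤ centralizerRank γ N := by
  have : Countable (Set.Iio α) := by
    rw [← Cardinal.mk_le_aleph0_iff, Cardinal.mk_Iio_ordinal, Cardinal.lift_le_aleph0,
      ← Cardinal.lt_aleph_one_iff]
    exact Cardinal.lt_omega_iff_card_lt.1 hα
  obtain ⟨ι, hι⟩ := exists_injective_nat (Set.Iio α)
  choose idx hidx using fun s => hγ (ShiftExt.deltaWord (SeqTree.lo s))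
  have hMC : SeqTree.toMarked (SeqTree.descending ι) ∈ classMC := by
    by_contra h
    exact SeqTree.descending_notMem_illFounded hι (SeqTree.notMem_classMC_iff.1 h)
  have hWF := isWF_centralizerTree hMC fun i => QuotientGroup.mk (γ i)
  refine ⟨_, ⟨hMC, ShiftExt.toMarked_mem_finGen _⟩, ?_⟩
  rw [centralizerRank, SeqTree.rank, dif_pos hWF, 
    dif_pos (show [] ∈ centralizerTree _ from IsCentralizerNode.nil)]
  refine le_trans ?_ (Order.le_succ _)
  exact SeqTree.le_nodeRank_nodeOf (fun s => by rw [hidx]) hWF α le_rfl List.Pairwise.nil (by simp)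

end MarkedGroup

theorem mainTheorem5 :
    (IsPi11 MarkedGroup.classMC ∧ ¬ MeasurableSet MarkedGroup.classMC) ∧
    (IsPi11 {N : MarkedGroup.finGen | (N : MarkedGroup) ∈ MarkedGroup.classMC} ∧
      ¬ MeasurableSet {N : MarkedGroup.finGen | (N : MarkedGroup) ∈ MarkedGroup.classMC}) ∧
    (∀ γ : ℕ → FreeGroup ℕ, Function.Surjective γ →
      (∀ N ∈ MarkedGroup.classMC, MarkedGroup.centralizerRank γ N < ω₁) ∧
      ∀ α : Ordinal.{0}, α < ω₁ →
        ∃ N ∈ MarkedGroup.classMC ∩ MarkedGroup.finGen,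
          α ≤ MarkedGroup.centralizerRank γ N) := by
  refine ⟨⟨MarkedGroup.isPi11_classMC, fun h =>
      MarkedGroup.not_measurableSet_classMC_finGen (measurable_subtype_coe h)⟩,
    ⟨MarkedGroup.isPi11_classMC.preimage measurable_subtype_coe,
      MarkedGroup.not_measurableSet_classMC_finGen⟩,
    fun γ hγ => ⟨fun N hN => ?_, fun α hα => MarkedGroup.exists_le_centralizerRank hγ hα⟩⟩
  exact SeqTree.rank_lt_omega_one (MarkedGroup.isWF_centralizerTree hN _)
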